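/- Let $\mathbb F$ be a finite field with $q$ elements and let $b, r \ge 0$ be integers. For a matrix $A\in\mathbb F^{n\times n}$ and $U,V\in\mathbb F^{n\times b}$ consider the sequence $S=\{U^TA^kV\}_{k\ge 0}$ of $b\times b$ matrices. A polynomial matrix $G=\sum_i G_i x^i\in\mathbb F[x]^{b\times b}$ generates $S$ if $\det G\ne 0$ and $\sum_i S_{k+i}G_i=0$ for all $k\ge 0$; it minimally generates $S$ if moreover its columns form a basis of the $\mathbb F[x]$-module of all $v=\sum_i v_ix^i\in\mathbb F[x]^b$ with $\sum_i S_{k+i}v_i=0$ for all $k\ge0$. The (monic) invariant factors of a nonsingular polynomial matrix are the diagonal entries of its Smith normal form, listed with the largest first, so that each divides the preceding one; the list is continued by $1$'s beyond the size of the matrix. Call $G$ $r$-faithful to $A$ if the $r$ largest invariant factors of $G$ are the $r$ largest invariant factors of $xI-A$. Let $P_{q,b,r}(A)$ be the probability, for independent and uniformly distributed $U,V\in\mathbb F^{n\times b}$, that a minimal generator $G$ of $\{U^TA^kV\}_{k\ge 0}$ is $r$-faithful to $A$ (this does not depend on the choice of $G$, since any two minimal generators of a sequence have the same Smith normal form).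 Theorem. Let $A$ and $B$ be square matrices over $\mathbb F$, of possibly different sizes, whose minimal polynomials are relatively prime. Then $$P_{q,b,r}(A\oplus B)=P_{q,b,r}(A)\,P_{q,b,r}(B).$$ -/

import Mathlib

open scoped Polynomial Matrix

namespace BlockWiedemann

variable {F : Type*} [Field F]

/-- The `(U, V)`-projection of `A`: the sequence of `b × b` matrices `Uᵀ A^k V`, `k = 0, 1, …`. -/
def projection {ι : Type*} [Fintype ι] [DecidableEq ι] {b : ℕ}
    (A : Matrix ι ι F) (U V : Matrix ι (Fin b) F) : ℕ → Matrix (Fin b) (Fin b) F :=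
  fun k => Uᵀ * A ^ k * V

/-- The action of a polynomial column `v = ∑ᵢ vᵢ xⁱ` (with `vᵢ ∈ F^b`) from the right on a matrix
sequence: `(S v)_k = ∑ᵢ S_{k+i} vᵢ`. -/
def seqMulVec {b : ℕ} (S : ℕ → Matrix (Fin b) (Fin b) F) (v : Fin b → F[X]) : ℕ → Fin b → F :=
  fun k a => ∑ j, (v j).sum fun i c => S (k + i) a j * c

/-- The action of a polynomial matrix `G = ∑ᵢ Gᵢ xⁱ` from the right on a matrix sequence:
`(S G)_k = ∑ᵢ S_{k+i} Gᵢ`, computed column by column. -/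
def seqMul {b : ℕ} (S : ℕ → Matrix (Fin b) (Fin b) F) (G : Matrix (Fin b) (Fin b) F[X]) :
    ℕ → Matrix (Fin b) (Fin b) F :=
  fun k => Matrix.of fun a c => seqMulVec S (fun j => G j c) k a

/-- `G` generates `S`: `det G ≠ 0` and `S G = 0`. -/
def Generates {b : ℕ} (S : ℕ → Matrix (Fin b) (Fin b) F)
    (G : Matrix (Fin b) (Fin b) F[X]) : Prop :=
  G.det ≠ 0 ∧ ∀ k, seqMul S G k = 0

/-- `G` minimally generates `S`: it generates `S`, and its columns (which are linearly independent
because `det G ≠ 0`) span the annihilator `{v ∈ F[x]^b | S v = 0}` over `F[x]`, so that they form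
a basis of it. -/
def MinimallyGenerates {b : ℕ} (S : ℕ → Matrix (Fin b) (Fin b) F)
    (G : Matrix (Fin b) (Fin b) F[X]) : Prop :=
  Generates S G ∧
    (Submodule.span F[X] (Set.range fun c : Fin b => fun j => G j c) : Set (Fin b → F[X])) =
      {v | ∀ k, seqMulVec S v k = 0}

/-- `s` lists the invariant factors of the nonsingular square polynomial matrix `M`, the largest
first: they are monic, each divides the preceding one, the list is continued by `1` beyond the size
of `M`, and `M` is unimodularly equivalent to the diagonal matrix that they form (its Smith normal
form; the bijection `e` only numbers the rows and columns). -/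
def IsInvariantFactors {ι : Type*} [Fintype ι] [DecidableEq ι]
    (M : Matrix ι ι F[X]) (s : ℕ → F[X]) : Prop :=
  (∀ i, (s i).Monic) ∧ (∀ i, s (i + 1) ∣ s i) ∧ (∀ i, Fintype.card ι ≤ i → s i = 1) ∧
    ∃ (e : ι ≃ Fin (Fintype.card ι)) (P Q : (Matrix ι ι F[X])ˣ),
      M = (P : Matrix ι ι F[X]) * Matrix.diagonal (fun i => s (e i)) * (Q : Matrix ι ι F[X])

/-- `G` is `r`-faithful to `A`: the `r` largest invariant factors of `G` are the `r` largest
invariant factors of `xI - A`. -/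
def Faithful {ι : Type*} [Fintype ι] [DecidableEq ι] {b : ℕ} (r : ℕ)
    (G : Matrix (Fin b) (Fin b) F[X]) (A : Matrix ι ι F) : Prop :=
  ∃ s t : ℕ → F[X], IsInvariantFactors G s ∧ IsInvariantFactors A.charmatrix t ∧
    ∀ i < r, s i = t i

/-- `P_{q,b,r}(A)` with `q = |F|`: the probability, for independent uniformly random
`U, V ∈ F^{n × b}`, that the minimal generator of the `(U, V)`-projection of `A` is `r`-faithful
to `A`. (Minimal generators exist and all have the same Smith normal form, so that it does not
matter which one is tested.) -/
noncomputable def faithfulProb {ι : Type*} [Fintype ι] [DecidableEq ι] (b r : ℕ)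
    (A : Matrix ι ι F) : ℚ :=
  (Nat.card {UV : Matrix ι (Fin b) F × Matrix ι (Fin b) F //
      ∃ G, MinimallyGenerates (projection A UV.1 UV.2) G ∧ Faithful r G A} : ℚ) /
    (Nat.card (Matrix ι (Fin b) F × Matrix ι (Fin b) F) : ℚ)

end BlockWiedemann

/-! Let `f` and `g` be the minimal polynomials of `A` and `B`. The sequence of `A ⊕ B` is the sum of
the sequences obtained from the row blocks of `U` and `V`. A Bézout identity for `f` and `g` gives a
polynomial acting as the identity on one summand and as zero on the other, so the sum is annihilated
exactly when both terms are: the annihilator of the sum is the intersection `L₁ ⊓ L₂`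
(`annihilator_fromBlocks`), with `f` killing the quotient by `L₁` and `g` the quotient by `L₂`.

Invariant factors are read off from the column module `L` through the numbers `dim M/(L + cM) = ∑
deg gcd(c, sᵢ)`, `c` ranging over all polynomials; these determine the chain `s`
(`chain_eq_of_sum_gcdDeg_eq`). By the Chinese remainder theorem they add up over `L₁ ⊓ L₂`
(`cokerDim_inf`), and they also add up over block diagonal matrices. Hence the invariant factors of
the generator and of `xI - (A ⊕ B)` are both termwise products of a divisor of `f` and a divisor of
`g`. Such products agree only if their factors agree, so faithfulness to `A ⊕ B` means faithfulness
to `A` and to `B`, and these two events concern disjoint blocks of rows. -/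

namespace BlockWiedemann

/-! ### Unimodular equivalence and diagonal matrices sorted by divisibility -/

section Equivalence

variable {R : Type*} [CommRing R] {ι κ : Type*} [Fintype ι] [DecidableEq ι]
  [Fintype κ] [DecidableEq κ]

/-- Two-sided equivalence of square matrices. -/
def UnimodEquiv (M N : Matrix ι ι R) : Prop :=
  ∃ P Q : (Matrix ι ι R)ˣ, M = (P : Matrix ι ι R) * N * (Q : Matrix ι ι R)

theorem UnimodEquiv.refl (M : Matrix ι ι R) : UnimodEquiv M M := ⟨1, 1, by simp⟩

theorem UnimodEquiv.trans {M N K : Matrix ι ι R} (h : UnimodEquiv M N) (h' : UnimodEquiv N K) :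
    UnimodEquiv M K := by
  obtain ⟨P, Q, rfl⟩ := h
  obtain ⟨P', Q', rfl⟩ := h'
  exact ⟨P * P', Q' * Q, by simp [mul_assoc]⟩

theorem UnimodEquiv.submatrix {M N : Matrix ι ι R} (h : UnimodEquiv M N) (e : κ ≃ ι) :
    UnimodEquiv (M.submatrix e e) (N.submatrix e e) := by
  obtain ⟨P, Q, rfl⟩ := h
  let φ : Matrix ι ι R →* Matrix κ κ R :=
    (Matrix.reindexAlgEquiv R R e.symm : Matrix ι ι R →* Matrix κ κ R)
  refine ⟨Units.map φ P, Units.map φ Q, ?_⟩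
  exact (map_mul φ _ _).trans (by rw [map_mul]; rfl)

theorem UnimodEquiv.fromBlocks {M M' : Matrix ι ι R} {N N' : Matrix κ κ R}
    (h : UnimodEquiv M M') (h' : UnimodEquiv N N') :
    UnimodEquiv (Matrix.fromBlocks M 0 0 N) (Matrix.fromBlocks M' 0 0 N') := by
  obtain ⟨P, Q, rfl⟩ := h
  obtain ⟨P', Q', rfl⟩ := h'
  let u (P : (Matrix ι ι R)ˣ) (P' : (Matrix κ κ R)ˣ) : (Matrix (ι ⊕ κ) (ι ⊕ κ) R)ˣ :=
    ⟨Matrix.fromBlocks P 0 0 P', Matrix.fromBlocks ↑P⁻¹ 0 0 ↑P'⁻¹,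
      by simp [Matrix.fromBlocks_multiply, Matrix.fromBlocks_one],
      by simp [Matrix.fromBlocks_multiply, Matrix.fromBlocks_one]⟩
  exact ⟨u P P', u Q Q', by simp [u, Matrix.fromBlocks_multiply]⟩

/-- The pair is replaced by its lcm and gcd. Both transforming matrices have determinant `u * a + v
* b = 1`. -/
theorem unimodEquiv_diagonal_fin_two {g a b u v : R} (h : u * a + v * b = 1) :
    UnimodEquiv (Matrix.diagonal ![g * a, g * b]) (Matrix.diagonal ![g * a * b, g]) := by
  let X : (Matrix (Fin 2) (Fin 2) R)ˣ := ⟨!![v, a; -u, b], !![b, -a; u, v],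
    by ext i j; fin_cases i <;> fin_cases j <;> simp [Matrix.mul_apply, Fin.sum_univ_two] <;> grind,
    by ext i j; fin_cases i <;> fin_cases j <;> simp [Matrix.mul_apply, Fin.sum_univ_two] <;> grind⟩
  let Y : (Matrix (Fin 2) (Fin 2) R)ˣ := ⟨!![1, -1; u * a, v * b], !![v * b, 1; -(u * a), 1],
    by ext i j; fin_cases i <;> fin_cases j <;> simp [Matrix.mul_apply, Fin.sum_univ_two] <;> grind,
    by ext i j; fin_cases i <;> fin_cases j <;> simp [Matrix.mul_apply, Fin.sum_univ_two] <;> grind⟩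
  refine ⟨X, Y, ?_⟩
  ext i j
  fin_cases i <;> fin_cases j <;> simp [X, Y, Matrix.mul_apply, Fin.sum_univ_two,
    Matrix.vecMul_diagonal] <;> grind

theorem unimodEquiv_diagonal_update {s : ι → R} {i j : ι} (hij : i ≠ j) {g a b u v : R}
    (h : u * a + v * b = 1) (hi : s i = g * a) (hj : s j = g * b) :
    UnimodEquiv (Matrix.diagonal s)
      (Matrix.diagonal (Function.update (Function.update s i (g * a * b)) j g)) := by
  let f : Fin 2 ⊕ {k // k ≠ i ∧ k ≠ j} → ι := Sum.elim ![i, j] Subtype.val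
  have hf : Function.Bijective f := by
    constructor
    · rintro (x | ⟨x, hx⟩) (y | ⟨y, hy⟩) hxy
      · fin_cases x <;> fin_cases y <;> simp_all [f]
      · fin_cases x
        exacts [absurd hxy.symm hy.1, absurd hxy.symm hy.2]
      · fin_cases y
        exacts [absurd hxy hx.1, absurd hxy hx.2]
      · simp_all [f]
    · intro k
      by_cases h1 : k = i
      · exact ⟨Sum.inl 0, by simp [f, h1]⟩
      by_cases h2 : k = j
      · exact ⟨Sum.inl 1, by simp [f, h2]⟩
      exact ⟨Sum.inr ⟨k, h1, h2⟩, rfl⟩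
  let e := Equiv.ofBijective f hf
  have key := ((unimodEquiv_diagonal_fin_two (g := g) h).fromBlocks
    (UnimodEquiv.refl (Matrix.diagonal fun k : {k // k ≠ i ∧ k ≠ j} => s k))).submatrix e.symm
  rw [Matrix.fromBlocks_diagonal, Matrix.fromBlocks_diagonal, Matrix.submatrix_diagonal_equiv,
    Matrix.submatrix_diagonal_equiv] at key
  convert key using 2
  · funext k
    obtain ⟨x, rfl⟩ := e.surjective k
    simp only [Function.comp, e.symm_apply_apply]
    rcases x with x | ⟨x, hx⟩
    · fin_cases x <;> simp [e, f, hi, hj]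
    · rfl
  · funext k
    obtain ⟨x, rfl⟩ := e.surjective k
    simp only [Function.comp, e.symm_apply_apply]
    rcases x with x | ⟨x, hx⟩
    · fin_cases x <;> simp [e, f, hij]
    · simp [e, f, hx.1, hx.2]

end Equivalence

variable {F : Type*} [Field F]

/-- Any two monic polynomials are cofactors times a monic greatest common divisor. -/
theorem exists_monic_gcd {p q : F[X]} (hp : p.Monic) :
    ∃ g a b u v : F[X], g.Monic ∧ p = g * a ∧ q = g * b ∧ u * a + v * b = 1 := by
  classical
  obtain ⟨g, hg⟩ := IsPrincipalIdealRing.principal (Ideal.span {p, q})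
  have hg : Ideal.span {p, q} = Ideal.span {g} := hg
  have hp0 := hp.ne_zero
  have hg0 : g ≠ 0 := by
    rintro rfl
    have : p ∈ Ideal.span {p, q} := Ideal.subset_span (by simp)
    rw [hg] at this
    simp_all
  have hn : (normalize g).Monic := Polynomial.monic_normalize hg0
  have hg' : Ideal.span {p, q} = Ideal.span {normalize g} := by
    rw [hg, Ideal.span_singleton_eq_span_singleton]
    exact (normalize_associated g).symm
  obtain ⟨a, ha⟩ : normalize g ∣ p := by
    rw [← Ideal.mem_span_singleton, ← hg']
    exact Ideal.subset_span (by simp)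
  obtain ⟨b, hb⟩ : normalize g ∣ q := by
    rw [← Ideal.mem_span_singleton, ← hg']
    exact Ideal.subset_span (by simp)
  obtain ⟨u, v, huv⟩ := Ideal.mem_span_pair.1
    (hg' ▸ Ideal.mem_span_singleton_self (normalize g) : normalize g ∈ Ideal.span {p, q})
  refine ⟨_, a, b, u, v, hn, ha, hb, mul_left_cancel₀ hn.ne_zero ?_⟩
  linear_combination huv - u * ha - v * hb

/-- As long as some `s j` with `i < j` fails to divide `s i`, the two entries are replaced by their
lcm and gcd; a weighted degree shows that this stops. -/
theorem exists_chain_diagonal {n : ℕ} (s : Fin n → F[X]) (hs : ∀ i, (s i).Monic) :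
    ∃ t : Fin n → F[X], (∀ i, (t i).Monic) ∧ (∀ i j, i < j → t j ∣ t i) ∧
      UnimodEquiv (Matrix.diagonal s) (Matrix.diagonal t) := by
  classical
  -- Weights decrease with the index, so moving degree from `j` to an earlier `i` raises `pot`,
  -- while `tot` is unchanged and bounds it by `n * tot`.
  let pot : (Fin n → F[X]) → ℕ := fun s => ∑ i, (n - i) * (s i).natDegree
  let tot : (Fin n → F[X]) → ℕ := fun s => ∑ i, (s i).natDegree
  have hle (s) : pot s ≤ n * tot s := by
    rw [Finset.mul_sum]
    exact Finset.sum_le_sum fun i _ => Nat.mul_le_mul_right _ (Nat.sub_le _ _)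
  induction hm : n * tot s - pot s using Nat.strong_induction_on generalizing s with
  | _ m ih =>
    by_cases hc : ∀ i j, i < j → s j ∣ s i
    · exact ⟨s, hs, hc, UnimodEquiv.refl _⟩
    push Not at hc
    obtain ⟨i, j, hij, hdvd⟩ := hc
    obtain ⟨g, a, b, u, v, hg, ha, hb, huv⟩ := exists_monic_gcd (q := s j) (hs i)
    have ham : a.Monic := hg.of_mul_monic_left (ha ▸ hs i)
    have hbm : b.Monic := hg.of_mul_monic_left (hb ▸ hs j)
    have hb1 : 0 < b.natDegree := by
      refine Nat.pos_of_ne_zero fun h0 => hdvd ?_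
      rw [hb, hbm.natDegree_eq_zero.1 h0, mul_one, ha]
      exact dvd_mul_right _ _
    let s' := Function.update (Function.update s i (g * a * b)) j g
    have hs'i : s' i = g * a * b := by simp [s', hij.ne]
    have hs'j : s' j = g := by simp [s']
    have hs'k (k) (h1 : k ≠ i) (h2 : k ≠ j) : s' k = s k := by simp [s', h1, h2]
    have hs' : ∀ k, (s' k).Monic := by
      intro k
      by_cases h2 : k = j
      · rw [h2, hs'j]; exact hg
      by_cases h1 : k = i
      · rw [h1, hs'i]; exact (hg.mul ham).mul hbm
      rw [hs'k k h1 h2]; exact hs k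
    have hsplit (f : Fin n → ℕ) :
        ∑ k, f k = f i + (f j + ∑ k ∈ (Finset.univ.erase i).erase j, f k) := by
      rw [Finset.add_sum_erase _ _ (by simp [hij.ne']), Finset.add_sum_erase _ _ (Finset.mem_univ i)]
    have hdi : (s i).natDegree = g.natDegree + a.natDegree := by rw [ha, hg.natDegree_mul ham]
    have hdj : (s j).natDegree = g.natDegree + b.natDegree := by rw [hb, hg.natDegree_mul hbm]
    have hdi' : (s' i).natDegree = g.natDegree + a.natDegree + b.natDegree := by
      rw [hs'i, (hg.mul ham).natDegree_mul hbm, hg.natDegree_mul ham]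
    have hrest (w : Fin n → ℕ) : ∑ k ∈ (Finset.univ.erase i).erase j, w k * (s' k).natDegree =
        ∑ k ∈ (Finset.univ.erase i).erase j, w k * (s k).natDegree := by
      refine Finset.sum_congr rfl fun k hk => ?_
      simp only [Finset.mem_erase] at hk
      rw [hs'k k hk.2.1 hk.1]
    have htot : tot s' = tot s := by
      have := hrest fun _ => 1
      simp only [one_mul] at this
      simp only [tot]
      rw [hsplit, hsplit (fun k => (s k).natDegree), this, hdi', hs'j, hdi, hdj]
      ring
    have hpot : pot s < pot s' := by
      simp only [pot]
      rw [hsplit, hsplit (fun k => (n - (k : ℕ)) * (s' k).natDegree), hrest fun k => n - (k : ℕ),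
        hdi', hs'j, hdi, hdj]
      have hlt : n - (j : ℕ) < n - (i : ℕ) := by have := i.2; have : (i : ℕ) < j := hij; omega
      have := Nat.mul_lt_mul_of_pos_right hlt hb1
      nlinarith
    have h1 := hle s'
    rw [htot] at h1
    obtain ⟨t, ht, htc, hte⟩ := ih _ (by rw [htot]; omega) s' hs' rfl
    exact ⟨t, ht, htc, (unimodEquiv_diagonal_update hij.ne huv ha hb).trans hte⟩

end BlockWiedemann

/-! ### Cokernel dimensions modulo a polynomial -/

namespace BlockWiedemann

section Coker

variable {F : Type*} [Field F] {ι κ : Type*} [Fintype ι] [DecidableEq ι]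
  [Fintype κ] [DecidableEq κ]

/-- Multiples of `c` in a module. -/
abbrev multiples {R : Type*} [CommRing R] (M : Type*) [AddCommGroup M] [Module R M] (c : R) :
    Submodule R M :=
  LinearMap.range (c • (LinearMap.id : M →ₗ[R] M))

/-- The dimension of `M / (L + c M)` over the base field. -/
noncomputable def cokerDim {M : Type*} [AddCommGroup M] [Module F[X] M] [Module F M]
    [IsScalarTower F F[X] M] (L : Submodule F[X] M) (c : F[X]) : ℕ :=
  Module.finrank F (M ⧸ (L ⊔ multiples M c))

open Classical in
/-- The degree of the greatest common divisor. -/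
noncomputable def gcdDeg (c a : F[X]) : ℕ := (EuclideanDomain.gcd c a).natDegree

open Classical in
-- `Q` does not change the range, and in the coordinates given by `P` the submodule `L + cM` is the
-- product of the ideals `(a i) + (c)`.
theorem exists_equiv_pi {L : Submodule F[X] (ι → F[X])} {P Q : (Matrix ι ι F[X])ˣ} {a : ι → F[X]}
    (hL : L = LinearMap.range
      ((P : Matrix ι ι F[X]) * Matrix.diagonal a * (Q : Matrix ι ι F[X])).mulVecLin) (c : F[X]) :
    Nonempty (((ι → F[X]) ⧸ (L ⊔ multiples (ι → F[X]) c)) ≃ₗ[F[X]]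
      ∀ i, F[X] ⧸ Ideal.span {EuclideanDomain.gcd c (a i)}) := by
  let p : ι → Submodule F[X] F[X] := fun i => Ideal.span {EuclideanDomain.gcd c (a i)}
  let T : (ι → F[X]) ≃ₗ[F[X]] (ι → F[X]) :=
    LinearEquiv.ofLinearMap (P : Matrix ι ι F[X]).mulVecLin (↑P⁻¹ : Matrix ι ι F[X]).mulVecLin
      (by rw [← Matrix.mulVecLin_mul]; simp) (by rw [← Matrix.mulVecLin_mul]; simp)
  refine ⟨(Submodule.Quotient.equiv _ _ T ?_).symm.trans (Submodule.quotientPi p)⟩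
  have hT (x) : T x = (P : Matrix ι ι F[X]) *ᵥ x := rfl
  apply le_antisymm
  · rintro _ ⟨x, hx, rfl⟩
    have hx (i) : EuclideanDomain.gcd c (a i) ∣ x i :=
      Ideal.mem_span_singleton.1 (hx i (Set.mem_univ i))
    choose y hy using hx
    -- Bézout coefficients split each multiple of the gcd into a multiple of `a i` and a multiple of
    -- `c`.
    have hxe : x = (Matrix.diagonal a) *ᵥ (fun i => EuclideanDomain.gcdB c (a i) * y i) +
        c • (fun i => EuclideanDomain.gcdA c (a i) * y i) := by
      funext i
      rw [hy, EuclideanDomain.gcd_eq_gcd_ab]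
      simp [Matrix.mulVec_diagonal]
      ring
    rw [hxe, map_add, map_smul]
    refine Submodule.add_mem_sup ?_ ⟨_, rfl⟩
    rw [hL]
    refine ⟨(↑Q⁻¹ : Matrix ι ι F[X]) *ᵥ (fun i => EuclideanDomain.gcdB c (a i) * y i), ?_⟩
    simp [hT, Matrix.mulVec_mulVec, Matrix.mul_assoc]
  · rw [sup_le_iff, hL]
    constructor
    · rintro _ ⟨x, rfl⟩
      refine ⟨Matrix.diagonal a *ᵥ ((Q : Matrix ι ι F[X]) *ᵥ x), fun i _ => ?_, ?_⟩
      · simp only [p, Matrix.mulVec_diagonal]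
        exact Ideal.mem_span_singleton.2 (dvd_mul_of_dvd_left (EuclideanDomain.gcd_dvd_right _ _) _)
      · simp [hT, Matrix.mulVec_mulVec, Matrix.mul_assoc]
    · rintro _ ⟨x, rfl⟩
      refine ⟨c • T.symm x, fun i _ => ?_, ?_⟩
      · exact Ideal.mem_span_singleton.2 (dvd_mul_of_dvd_left (EuclideanDomain.gcd_dvd_left _ _) _)
      · simp

/-- Nonzero `a i` keep every gcd nonzero, so the quotient is finite-dimensional even for `c = 0`. -/
theorem cokerDim_eq_sum {L : Submodule F[X] (ι → F[X])} {P Q : (Matrix ι ι F[X])ˣ} {a : ι → F[X]}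
    (hL : L = LinearMap.range
      ((P : Matrix ι ι F[X]) * Matrix.diagonal a * (Q : Matrix ι ι F[X])).mulVecLin)
    (ha : ∀ i, a i ≠ 0) (c : F[X]) :
    Module.Finite F ((ι → F[X]) ⧸ (L ⊔ multiples (ι → F[X]) c)) ∧
      cokerDim L c = ∑ i, gcdDeg c (a i) := by
  classical
  obtain ⟨T⟩ := exists_equiv_pi hL c
  have hg (i) : EuclideanDomain.gcd c (a i) ≠ 0 := fun h =>
    ha i (EuclideanDomain.gcd_eq_zero_iff.1 h).2
  have hfin (i) : Module.Finite F (F[X] ⧸ Ideal.span {EuclideanDomain.gcd c (a i)}) := by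
    exact PowerBasis.finite (AdjoinRoot.powerBasis (hg i))
  refine ⟨Module.Finite.equiv (T.restrictScalars F).symm, ?_⟩
  rw [cokerDim, (T.restrictScalars F).finrank_eq, Module.finrank_pi_fintype]
  exact Finset.sum_congr rfl fun i _ => finrank_quotient_span_eq_natDegree

/-- Chinese remainder theorem: `f` kills the first quotient and `g` the second, so the map to their
product is onto, with kernel `(L₁ ⊓ L₂) + cM`. -/
theorem cokerDim_inf {M : Type*} [AddCommGroup M] [Module F[X] M] [Module F M]
    [IsScalarTower F F[X] M] {L₁ L₂ : Submodule F[X] M} {f g c : F[X]} (hfg : IsCoprime f g)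
    (h₁ : ∀ x, f • x ∈ L₁) (h₂ : ∀ x, g • x ∈ L₂)
    (hf₁ : Module.Finite F (M ⧸ (L₁ ⊔ multiples M c)))
    (hf₂ : Module.Finite F (M ⧸ (L₂ ⊔ multiples M c))) :
    cokerDim (L₁ ⊓ L₂) c = cokerDim L₁ c + cokerDim L₂ c := by
  obtain ⟨u, v, huv⟩ := hfg
  set K₁ := L₁ ⊔ multiples M c
  set K₂ := L₂ ⊔ multiples M c
  have hsplit (x : M) : x = u • f • x + v • g • x := by
    rw [smul_smul, smul_smul, ← add_smul, huv, one_smul]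
  have hK : (L₁ ⊓ L₂) ⊔ multiples M c = K₁ ⊓ K₂ := by
    apply le_antisymm
    · exact le_inf (sup_le_sup_right inf_le_left _) (sup_le_sup_right inf_le_right _)
    · rintro x ⟨hx₁, hx₂⟩
      obtain ⟨l₁, hl₁, _, ⟨y₁, rfl⟩, h1⟩ := Submodule.mem_sup.1 hx₁
      obtain ⟨l₂, hl₂, _, ⟨y₂, rfl⟩, h2⟩ := Submodule.mem_sup.1 hx₂
      -- The part `u • f • x` is expanded by the `K₂`-decomposition and `v • g • x` by the other
      -- one, so that each `L`-term lies in both submodules.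
      have : x = (u • f • l₂ + v • g • l₁) + c • (u • f • y₂ + v • g • y₁) := by
        conv_lhs => rw [hsplit x]
        conv_lhs => enter [1]; rw [← h2]
        conv_lhs => enter [2]; rw [← h1]
        simp only [LinearMap.smul_apply, LinearMap.id_apply]
        module
      rw [this]
      refine Submodule.add_mem_sup ⟨?_, ?_⟩ ⟨_, rfl⟩
      · exact L₁.add_mem (L₁.smul_mem _ (h₁ _)) (L₁.smul_mem _ (L₁.smul_mem _ hl₁))
      · exact L₂.add_mem (L₂.smul_mem _ (L₂.smul_mem _ hl₂)) (L₂.smul_mem _ (h₂ _))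
  let φ : M →ₗ[F[X]] (M ⧸ K₁) × (M ⧸ K₂) := K₁.mkQ.prod K₂.mkQ
  have hφ : Function.Surjective φ := by
    rintro ⟨x, y⟩
    obtain ⟨x, rfl⟩ := K₁.mkQ_surjective x
    obtain ⟨y, rfl⟩ := K₂.mkQ_surjective y
    -- Modulo `K₁`, `u • f` acts as `0` and `v • g` as `1`; modulo `K₂` the roles are exchanged.
    refine ⟨v • g • x + u • f • y, ?_⟩
    refine Prod.ext ((Submodule.Quotient.eq _).2 ?_) ((Submodule.Quotient.eq _).2 ?_)
    · have : v • g • x + u • f • y - x = u • f • (y - x) := by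
        conv_lhs => enter [2]; rw [hsplit x]
        module
      rw [this]
      exact K₁.smul_mem _ (le_sup_left (a := L₁) (h₁ _))
    · have : v • g • x + u • f • y - y = v • g • (x - y) := by
        conv_lhs => enter [2]; rw [hsplit y]
        module
      rw [this]
      exact K₂.smul_mem _ (le_sup_left (a := L₂) (h₂ _))
  have hker : LinearMap.ker φ = (L₁ ⊓ L₂) ⊔ multiples M c := by
    rw [hK, LinearMap.ker_prod, Submodule.ker_mkQ, Submodule.ker_mkQ]
  let T := (Submodule.quotEquivOfEq _ _ hker).symm.trans (φ.quotKerEquivOfSurjective hφ)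
  rw [cokerDim, (T.restrictScalars F).finrank_eq, Module.finrank_prod]
  rfl

end Coker

/-! ### Divisibility chains are determined by their gcd-degrees -/

section Gcd

variable {F : Type*} [Field F]

theorem gcdDeg_eq_of_associated {c a g : F[X]} (h₁ : g ∣ c) (h₂ : g ∣ a)
    (h : ∀ d, d ∣ c → d ∣ a → d ∣ g) : gcdDeg c a = g.natDegree := by
  classical
  refine Polynomial.natDegree_eq_of_degree_eq (Polynomial.degree_eq_degree_of_associated
    (associated_of_dvd_dvd ?_ ?_))
  · exact h _ (EuclideanDomain.gcd_dvd_left _ _) (EuclideanDomain.gcd_dvd_right _ _)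
  · exact EuclideanDomain.dvd_gcd h₁ h₂

theorem gcdDeg_of_dvd_right {c a : F[X]} (h : a ∣ c) : gcdDeg c a = a.natDegree :=
  gcdDeg_eq_of_associated h dvd_rfl fun _ _ h => h

theorem gcdDeg_one (c : F[X]) : gcdDeg c 1 = 0 := by
  simp [gcdDeg_of_dvd_right (one_dvd c)]

theorem gcdDeg_of_dvd_left {c a : F[X]} (h : c ∣ a) : gcdDeg c a = c.natDegree :=
  gcdDeg_eq_of_associated dvd_rfl h fun _ h _ => h

theorem gcdDeg_le {c a : F[X]} (hc : c ≠ 0) : gcdDeg c a ≤ c.natDegree := by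
  classical
  exact Polynomial.natDegree_le_of_dvd (EuclideanDomain.gcd_dvd_left _ _) hc

theorem dvd_of_gcdDeg_eq {c a : F[X]} (hc : c ≠ 0) (h : gcdDeg c a = c.natDegree) : c ∣ a := by
  classical
  have := Polynomial.associated_of_dvd_of_natDegree_le (EuclideanDomain.gcd_dvd_left c a) hc h.ge
  exact this.symm.dvd.trans (EuclideanDomain.gcd_dvd_right _ _)

theorem gcdDeg_mul {c a b : F[X]} (hab : IsCoprime a b) (ha : a ≠ 0) (hb : b ≠ 0) :
    gcdDeg c (a * b) = gcdDeg c a + gcdDeg c b := by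
  classical
  have h0 {x : F[X]} (hx : x ≠ 0) : EuclideanDomain.gcd c x ≠ 0 := fun h =>
    hx (EuclideanDomain.gcd_eq_zero_iff.1 h).2
  rw [gcdDeg_eq_of_associated (g := EuclideanDomain.gcd c a * EuclideanDomain.gcd c b),
    Polynomial.natDegree_mul (h0 ha) (h0 hb)]
  · rfl
  · refine IsCoprime.mul_dvd ?_ (EuclideanDomain.gcd_dvd_left _ _) (EuclideanDomain.gcd_dvd_left _ _)
    exact hab.of_isCoprime_of_dvd_left (EuclideanDomain.gcd_dvd_right _ _)
      |>.of_isCoprime_of_dvd_right (EuclideanDomain.gcd_dvd_right _ _)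
  · exact mul_dvd_mul (EuclideanDomain.gcd_dvd_right _ _) (EuclideanDomain.gcd_dvd_right _ _)
  · intro d hd hdab
    obtain ⟨d₁, d₂, h₁, h₂, rfl⟩ := exists_dvd_and_dvd_of_dvd_mul hdab
    exact mul_dvd_mul (EuclideanDomain.dvd_gcd ((dvd_mul_right _ _).trans hd) h₁)
      (EuclideanDomain.dvd_gcd ((dvd_mul_left _ _).trans hd) h₂)

theorem dvd_of_le_of_chain {s : ℕ → F[X]} (hs : ∀ i, s (i + 1) ∣ s i) {i j : ℕ} (h : i ≤ j) :
    s j ∣ s i := by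
  induction j, h using Nat.le_induction with
  | base => exact dvd_rfl
  | succ k _ ih => exact (hs k).trans ih

/-- Test with `c = s i`: the tails cancel, each remaining term on the left has the maximal value
`deg (s i)`, so each on the right must attain it too. -/
theorem chain_dvd_of_sum_gcdDeg_eq {s t : ℕ → F[X]} {N i : ℕ} (hs : ∀ i, (s i).Monic)
    (hsc : ∀ i, s (i + 1) ∣ s i) (hi : i < N) (htail : ∀ j, i < j → s j = t j)
    (h : ∀ c, ∑ i ∈ Finset.range N, gcdDeg c (s i) = ∑ i ∈ Finset.range N, gcdDeg c (t i)) :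
    s i ∣ t i := by
  have h := h (s i)
  rw [← Finset.sum_range_add_sum_Ico _ (Nat.succ_le_of_lt hi),
    ← Finset.sum_range_add_sum_Ico (fun j => gcdDeg (s i) (t j)) (Nat.succ_le_of_lt hi)] at h
  have htl : ∑ j ∈ Finset.Ico i.succ N, gcdDeg (s i) (s j) =
      ∑ j ∈ Finset.Ico i.succ N, gcdDeg (s i) (t j) :=
    Finset.sum_congr rfl fun j hj => by rw [htail j (Finset.mem_Ico.1 hj).1]
  have hd : ∑ j ∈ Finset.range i.succ, gcdDeg (s i) (s j) =
      ∑ j ∈ Finset.range i.succ, (s i).natDegree :=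
    Finset.sum_congr rfl fun j hj => gcdDeg_of_dvd_left
      (dvd_of_le_of_chain hsc (Nat.lt_succ_iff.1 (Finset.mem_range.1 hj)))
  have heq : ∑ j ∈ Finset.range i.succ, gcdDeg (s i) (t j) =
      ∑ j ∈ Finset.range i.succ, (s i).natDegree := by omega
  exact dvd_of_gcdDeg_eq (hs i).ne_zero ((Finset.sum_eq_sum_iff_of_le
    fun j _ => gcdDeg_le (hs i).ne_zero).1 heq i (Finset.self_mem_range_succ i))

theorem chain_eq_of_sum_gcdDeg_eq {s t : ℕ → F[X]} {N : ℕ} (hs : ∀ i, (s i).Monic)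
    (ht : ∀ i, (t i).Monic) (hsc : ∀ i, s (i + 1) ∣ s i) (htc : ∀ i, t (i + 1) ∣ t i)
    (hs1 : ∀ i, N ≤ i → s i = 1) (ht1 : ∀ i, N ≤ i → t i = 1)
    (h : ∀ c, ∑ i ∈ Finset.range N, gcdDeg c (s i) = ∑ i ∈ Finset.range N, gcdDeg c (t i)) :
    s = t := by
  -- Descending from the end of the lists, where both are `1`; the lemma above applies in both
  -- directions.
  have key : ∀ m i, N - m ≤ i → s i = t i := by
    intro m
    induction m with
    | zero => exact fun i hi => (hs1 i hi).trans (ht1 i hi).symm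
    | succ m ih =>
      intro i hi
      by_cases hi' : N - m ≤ i
      · exact ih i hi'
      have htail (j) (hj : i < j) : s j = t j := ih j (by omega)
      exact Polynomial.eq_of_dvd_of_natDegree_le_of_leadingCoeff
        (chain_dvd_of_sum_gcdDeg_eq hs hsc (by omega) htail h)
        (Polynomial.natDegree_le_of_dvd (chain_dvd_of_sum_gcdDeg_eq ht htc (by omega)
          (fun j hj => (htail j hj).symm) fun c => (h c).symm) (hs i).ne_zero)
        ((hs i).leadingCoeff.trans (ht i).leadingCoeff.symm)
  exact funext fun i => key N i (by omega)

end Gcd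

end BlockWiedemann

/-! ### Invariant factors: existence, uniqueness, products -/

namespace BlockWiedemann

variable {F : Type*} [Field F] {ι κ : Type*} [Fintype ι] [DecidableEq ι]
  [Fintype κ] [DecidableEq κ]

theorem exists_range_eq_of_smul_mem {L : Submodule F[X] (ι → F[X])} {f : F[X]} (hf : f ≠ 0)
    (hL : ∀ x, f • x ∈ L) :
    ∃ (P : (Matrix ι ι F[X])ˣ) (a : ι → F[X]), (∀ i, a i ≠ 0) ∧
      L = LinearMap.range ((P : Matrix ι ι F[X]) * Matrix.diagonal a).mulVecLin := by
  -- Multiplication by `f` embeds the whole free module into `L`, which therefore has full rank.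
  have hrank : Module.finrank F[X] L = Module.finrank F[X] (ι → F[X]) := by
    apply le_antisymm (Submodule.finrank_le L)
    refine LinearMap.finrank_le_finrank_of_injective
      (f := LinearMap.codRestrict L (f • LinearMap.id) hL) ?_
    intro x y hxy
    exact smul_right_injective _ hf (congrArg Subtype.val hxy)
  obtain ⟨b, a, b', hb⟩ := Submodule.exists_smith_normal_form_of_rank_eq
    (Pi.basisFun F[X] ι) hrank
  let P : (Matrix ι ι F[X])ˣ :=
    ⟨(Pi.basisFun F[X] ι).toMatrix b, b.toMatrix (Pi.basisFun F[X] ι),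
      Module.Basis.toMatrix_mul_toMatrix_flip _ _, Module.Basis.toMatrix_mul_toMatrix_flip _ _⟩
  refine ⟨P, a, fun i hi => b'.ne_zero i (Subtype.ext (by simp [hb, hi])), ?_⟩
  rw [Matrix.range_mulVecLin]
  have hcol : ((P : Matrix ι ι F[X]) * Matrix.diagonal a).col = fun i => (b' i : ι → F[X]) := by
    funext i j
    simp [P, hb, Module.Basis.toMatrix_apply, mul_comm]
  have hspan := congrArg (Submodule.map L.subtype) b'.span_eq
  rw [Submodule.map_span, ← Set.range_comp, Submodule.map_top, Submodule.range_subtype] at hspan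
  rw [hcol]
  exact hspan.symm

theorem smul_mem_range_of_det (M : Matrix ι ι F[X]) (x : ι → F[X]) :
    M.det • x ∈ LinearMap.range M.mulVecLin :=
  ⟨M.adjugate *ᵥ x, by simp [Matrix.mulVec_mulVec, Matrix.mul_adjugate, Matrix.smul_mulVec]⟩

theorem exists_eq_mul_of_range_le {G H : Matrix ι ι F[X]}
    (h : LinearMap.range G.mulVecLin ≤ LinearMap.range H.mulVecLin) :
    ∃ Q : Matrix ι ι F[X], G = H * Q := by
  have hc (c : ι) : ∃ q, H *ᵥ q = G.col c := by
    obtain ⟨q, hq⟩ := h ⟨Pi.single c 1, rfl⟩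
    exact ⟨q, by simpa using hq⟩
  choose q hq using hc
  refine ⟨Matrix.of fun i c => q c i, ?_⟩
  refine Matrix.ext fun i c => ?_
  exact (congrFun (hq c) i).symm

theorem exists_eq_mul_unit_of_range_eq {G H : Matrix ι ι F[X]} (hG : G.det ≠ 0)
    (h : LinearMap.range G.mulVecLin = LinearMap.range H.mulVecLin) :
    ∃ Q : (Matrix ι ι F[X])ˣ, G = H * (Q : Matrix ι ι F[X]) := by
  obtain ⟨Q, hQ⟩ := exists_eq_mul_of_range_le h.le
  obtain ⟨Q', hQ'⟩ := exists_eq_mul_of_range_le h.ge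
  have hdet : Q'.det * Q.det = 1 := by
    apply mul_left_cancel₀ hG
    have := congrArg Matrix.det hQ
    rw [hQ', Matrix.det_mul, Matrix.det_mul] at this
    linear_combination -this
  have hu : IsUnit Q := (Matrix.isUnit_iff_isUnit_det _).2 (IsUnit.of_mul_eq_one_right _ hdet)
  exact ⟨hu.unit, hQ⟩

theorem unimodEquiv_diagonal_monic {a : ι → F[X]} (ha : ∀ i, a i ≠ 0) :
    ∃ s : ι → F[X], (∀ i, (s i).Monic) ∧ UnimodEquiv (Matrix.diagonal a) (Matrix.diagonal s) := by
  have hc (i) : (a i).leadingCoeff ≠ 0 := Polynomial.leadingCoeff_ne_zero.2 (ha i)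
  refine ⟨fun i => a i * Polynomial.C (a i).leadingCoeff⁻¹,
    fun i => Polynomial.monic_mul_leadingCoeff_inv (ha i), 1,
    ⟨Matrix.diagonal fun i => Polynomial.C (a i).leadingCoeff,
      Matrix.diagonal fun i => Polynomial.C (a i).leadingCoeff⁻¹, ?_, ?_⟩, ?_⟩
  · rw [Matrix.diagonal_mul_diagonal, ← Matrix.diagonal_one]
    congr 1; funext i
    rw [← Polynomial.C_mul, mul_inv_cancel₀ (hc i), Polynomial.C_1]
  · rw [Matrix.diagonal_mul_diagonal, ← Matrix.diagonal_one]
    congr 1; funext i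
    rw [← Polynomial.C_mul, inv_mul_cancel₀ (hc i), Polynomial.C_1]
  · simp only [Units.val_one, one_mul, Matrix.diagonal_mul_diagonal]
    congr 1; funext i
    rw [mul_assoc, ← Polynomial.C_mul, inv_mul_cancel₀ (hc i), Polynomial.C_1, mul_one]

/-- A Smith basis of the column module yields a matrix with the same column module, hence equal to
`M` up to a unit on the right; its diagonal is then made monic and sorted. -/
theorem exists_isInvariantFactors {M : Matrix ι ι F[X]} (hM : M.det ≠ 0) :
    ∃ s, IsInvariantFactors M s := by
  obtain ⟨P, a, ha, hL⟩ := exists_range_eq_of_smul_mem hM (smul_mem_range_of_det M)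
  obtain ⟨Q, hQ⟩ := exists_eq_mul_unit_of_range_eq hM hL
  obtain ⟨s, hs, has⟩ := unimodEquiv_diagonal_monic ha
  let e := Fintype.equivFin ι
  obtain ⟨t, ht, htc, hst⟩ := exists_chain_diagonal (s ∘ e.symm) fun i => hs _
  have hst := hst.submatrix e
  rw [Matrix.submatrix_diagonal_equiv, Matrix.submatrix_diagonal_equiv, Function.comp_assoc,
    e.symm_comp_self, Function.comp_id] at hst
  have h1 : UnimodEquiv M (Matrix.diagonal a) := ⟨P, Q, hQ⟩
  obtain ⟨P', Q', h⟩ := (h1.trans has).trans hst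
  refine ⟨fun k => if h : k < Fintype.card ι then t ⟨k, h⟩ else 1, fun i => ?_, fun i => ?_,
    fun i hi => dif_neg hi.not_gt, e, P', Q', ?_⟩
  · dsimp only
    split_ifs
    exacts [ht _, Polynomial.monic_one]
  · dsimp only
    split_ifs with h1 h2
    · exact htc _ _ (Nat.lt_succ_self i)
    · omega
    · exact one_dvd _
    · exact one_dvd _
  · rw [h]
    congr 3
    funext i
    simp

/-- Padding by `1` adds nothing to the sum; the free bound `N` allows matrices of different sizes to
be compared. -/
theorem IsInvariantFactors.cokerDim_eq {M : Matrix ι ι F[X]} {s : ℕ → F[X]}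
    (h : IsInvariantFactors M s) {N : ℕ} (hN : Fintype.card ι ≤ N) (c : F[X]) :
    Module.Finite F ((ι → F[X]) ⧸ (LinearMap.range M.mulVecLin ⊔ multiples (ι → F[X]) c)) ∧
      cokerDim (LinearMap.range M.mulVecLin) c = ∑ i ∈ Finset.range N, gcdDeg c (s i) := by
  obtain ⟨hm, -, h1, e, P, Q, rfl⟩ := h
  obtain ⟨hf, hd⟩ := cokerDim_eq_sum rfl (fun i => (hm (e i)).ne_zero) c
  refine ⟨hf, hd.trans ?_⟩
  rw [e.sum_comp fun i : Fin (Fintype.card ι) => gcdDeg c (s i),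
    Fin.sum_univ_eq_sum_range fun i => gcdDeg c (s i)]
  refine Finset.sum_subset (Finset.range_mono hN) fun i _ hi => ?_
  rw [h1 i (not_lt.1 fun h => hi (Finset.mem_range.2 h)), gcdDeg_one]

/-- Apply the hypothesis to the image under `P` of a unit vector and read one coordinate. This makes
the factors of the two summands coprime. -/
theorem IsInvariantFactors.dvd_of_smul_mem {M : Matrix ι ι F[X]} {s : ℕ → F[X]}
    (h : IsInvariantFactors M s) {f : F[X]} (hf : ∀ x, f • x ∈ LinearMap.range M.mulVecLin)
    (i : ℕ) : s i ∣ f := by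
  obtain ⟨-, -, h1, e, P, Q, rfl⟩ := h
  by_cases hi : i < Fintype.card ι
  · obtain ⟨j, hj⟩ := e.surjective ⟨i, hi⟩
    obtain ⟨w, hw⟩ := hf ((P : Matrix ι ι F[X]) *ᵥ Pi.single j 1)
    have hw := congrArg (fun x => ((↑P⁻¹ : Matrix ι ι F[X]) *ᵥ x) j) hw
    simp only [Matrix.mulVecLin_apply, Matrix.mulVec_smul, Matrix.mulVec_mulVec,
      ← mul_assoc, Units.inv_mul, one_mul, Matrix.one_mulVec, Pi.smul_apply, Pi.single_eq_same,
      smul_eq_mul, mul_one] at hw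
    rw [← Matrix.mulVec_mulVec, Matrix.mulVec_diagonal, hj] at hw
    exact ⟨_, hw.symm⟩
  · rw [h1 i (not_lt.1 hi)]
    exact one_dvd _

theorem IsInvariantFactors.unique {M N : Matrix ι ι F[X]} {s t : ℕ → F[X]}
    (hs : IsInvariantFactors M s) (ht : IsInvariantFactors N t)
    (h : LinearMap.range M.mulVecLin = LinearMap.range N.mulVecLin) : s = t :=
  chain_eq_of_sum_gcdDeg_eq hs.1 ht.1 hs.2.1 ht.2.1 hs.2.2.1 ht.2.2.1 fun c => by
    rw [← (hs.cokerDim_eq le_rfl c).2, ← (ht.cokerDim_eq le_rfl c).2, h]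

/-- A chain whose gcd-degrees add up from those of two mutually coprime chains is the product. -/
theorem chain_eq_mul {s s₁ s₂ : ℕ → F[X]} {N : ℕ} (hs : ∀ i, (s i).Monic)
    (hs₁ : ∀ i, (s₁ i).Monic) (hs₂ : ∀ i, (s₂ i).Monic) (hsc : ∀ i, s (i + 1) ∣ s i)
    (hsc₁ : ∀ i, s₁ (i + 1) ∣ s₁ i) (hsc₂ : ∀ i, s₂ (i + 1) ∣ s₂ i)
    (h1 : ∀ i, N ≤ i → s i = 1) (h1₁ : ∀ i, N ≤ i → s₁ i = 1) (h1₂ : ∀ i, N ≤ i → s₂ i = 1)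
    (hco : ∀ i, IsCoprime (s₁ i) (s₂ i))
    (h : ∀ c, ∑ i ∈ Finset.range N, gcdDeg c (s i) =
      ∑ i ∈ Finset.range N, gcdDeg c (s₁ i) + ∑ i ∈ Finset.range N, gcdDeg c (s₂ i)) :
    s = fun i => s₁ i * s₂ i :=
  chain_eq_of_sum_gcdDeg_eq hs (fun i => (hs₁ i).mul (hs₂ i)) hsc
    (fun i => mul_dvd_mul (hsc₁ i) (hsc₂ i)) h1 (fun i hi => by rw [h1₁ i hi, h1₂ i hi, one_mul])
    fun c => by
      rw [h, ← Finset.sum_add_distrib]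
      exact Finset.sum_congr rfl fun i _ =>
        (gcdDeg_mul (hco i) (hs₁ i).ne_zero (hs₂ i).ne_zero).symm

theorem IsInvariantFactors.eq_mul_of_range_inf {M M₁ M₂ : Matrix ι ι F[X]} {s s₁ s₂ : ℕ → F[X]}
    (hs : IsInvariantFactors M s) (hs₁ : IsInvariantFactors M₁ s₁)
    (hs₂ : IsInvariantFactors M₂ s₂) {f g : F[X]} (hfg : IsCoprime f g)
    (h₁ : ∀ x, f • x ∈ LinearMap.range M₁.mulVecLin)
    (h₂ : ∀ x, g • x ∈ LinearMap.range M₂.mulVecLin)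
    (h : LinearMap.range M.mulVecLin =
      LinearMap.range M₁.mulVecLin ⊓ LinearMap.range M₂.mulVecLin) :
    s = fun i => s₁ i * s₂ i := by
  refine chain_eq_mul hs.1 hs₁.1 hs₂.1 hs.2.1 hs₁.2.1 hs₂.2.1 hs.2.2.1 hs₁.2.2.1 hs₂.2.2.1
    (fun i => (hfg.of_isCoprime_of_dvd_left (hs₁.dvd_of_smul_mem h₁ i)).of_isCoprime_of_dvd_right
      (hs₂.dvd_of_smul_mem h₂ i)) fun c => ?_
  obtain ⟨hf₁, hd₁⟩ := hs₁.cokerDim_eq le_rfl c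
  obtain ⟨hf₂, hd₂⟩ := hs₂.cokerDim_eq le_rfl c
  rw [← hd₁, ← hd₂, ← (hs.cokerDim_eq le_rfl c).2, h, cokerDim_inf hfg h₁ h₂ hf₁ hf₂]

theorem IsInvariantFactors.eq_mul_of_fromBlocks {M₁ : Matrix ι ι F[X]} {M₂ : Matrix κ κ F[X]}
    {s s₁ s₂ : ℕ → F[X]} (hs : IsInvariantFactors (Matrix.fromBlocks M₁ 0 0 M₂) s)
    (hs₁ : IsInvariantFactors M₁ s₁) (hs₂ : IsInvariantFactors M₂ s₂) {f g : F[X]}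
    (hfg : IsCoprime f g) (h₁ : ∀ x, f • x ∈ LinearMap.range M₁.mulVecLin)
    (h₂ : ∀ x, g • x ∈ LinearMap.range M₂.mulVecLin) :
    s = fun i => s₁ i * s₂ i := by
  have hcard : Fintype.card (ι ⊕ κ) = Fintype.card ι + Fintype.card κ := Fintype.card_sum
  refine chain_eq_mul (N := Fintype.card (ι ⊕ κ)) hs.1 hs₁.1 hs₂.1 hs.2.1 hs₁.2.1 hs₂.2.1
    hs.2.2.1 (fun i hi => hs₁.2.2.1 i (by omega)) (fun i hi => hs₂.2.2.1 i (by omega))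
    (fun i => (hfg.of_isCoprime_of_dvd_left (hs₁.dvd_of_smul_mem h₁ i)).of_isCoprime_of_dvd_right
      (hs₂.dvd_of_smul_mem h₂ i)) fun c => ?_
  rw [← (hs.cokerDim_eq le_rfl c).2, ← (hs₁.cokerDim_eq (by omega) c).2,
    ← (hs₂.cokerDim_eq (by omega) c).2]
  obtain ⟨hm₁, -, -, e₁, P₁, Q₁, hM₁⟩ := hs₁
  obtain ⟨hm₂, -, -, e₂, P₂, Q₂, hM₂⟩ := hs₂
  obtain ⟨P, Q, hPQ⟩ := UnimodEquiv.fromBlocks ⟨P₁, Q₁, hM₁⟩ ⟨P₂, Q₂, hM₂⟩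
  rw [Matrix.fromBlocks_diagonal] at hPQ
  rw [(cokerDim_eq_sum (by rw [hPQ]) (by
      rintro (i | i)
      exacts [(hm₁ _).ne_zero, (hm₂ _).ne_zero]) c).2,
    (cokerDim_eq_sum (by rw [hM₁]) (fun i => (hm₁ _).ne_zero) c).2,
    (cokerDim_eq_sum (by rw [hM₂]) (fun i => (hm₂ _).ne_zero) c).2, Fintype.sum_sum_type]
  rfl

/-- The matrix form of `x - a ∣ p(x) - p(a)`. For the minimal polynomial, `p(A) = 0`, so that `p`
kills the cokernel of `xI - A`. -/
theorem charmatrix_dvd_scalar_sub (A : Matrix ι ι F) (p : F[X]) :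
    A.charmatrix ∣ Matrix.scalar ι p - (Polynomial.aeval A p).map Polynomial.C := by
  have hC : A.map Polynomial.C = Matrix.scalar ι Polynomial.X - A.charmatrix := by
    simp [Matrix.charmatrix]
  induction p using Polynomial.induction_on with
  | C a =>
    convert dvd_zero A.charmatrix
    rw [sub_eq_zero]
    ext i j
    simp [Matrix.algebraMap_eq_diagonal, Matrix.diagonal_apply, apply_ite]
  | add p q hp hq =>
    convert dvd_add hp hq using 1
    rw [map_add, map_add, Matrix.map_add _ (map_add Polynomial.C)]
    abel
  | monomial n a ih =>
    rw [pow_succ', mul_left_comm]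
    generalize Polynomial.C a * Polynomial.X ^ n = q at ih
    -- Telescoping: `x q - A q(A) = (q - q(A)) x + (x - A) q(A)`.
    have h1 : Matrix.scalar ι (Polynomial.X * q) -
        (Polynomial.aeval A (Polynomial.X * q)).map Polynomial.C =
        (Matrix.scalar ι q - (Polynomial.aeval A q).map Polynomial.C) *
            Matrix.scalar ι Polynomial.X +
        A.charmatrix * (Polynomial.aeval A q).map Polynomial.C := by
      rw [map_mul, map_mul (Polynomial.aeval A), Matrix.map_mul, Polynomial.aeval_X, hC,
        sub_mul, sub_mul, (Matrix.scalar_commute Polynomial.X (fun r => Commute.all _ _)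
          (Matrix.scalar ι q)).eq,
        (Matrix.scalar_commute Polynomial.X (fun r => Commute.all _ _)
          ((Polynomial.aeval A q).map Polynomial.C)).eq]
      abel
    rw [h1]
    exact dvd_add (Dvd.dvd.mul_right ih _) (dvd_mul_right _ _)

theorem minpoly_smul_mem_range_charmatrix (A : Matrix ι ι F) (x : ι → F[X]) :
    minpoly F A • x ∈ LinearMap.range A.charmatrix.mulVecLin := by
  obtain ⟨C, hC⟩ := charmatrix_dvd_scalar_sub A (minpoly F A)
  rw [minpoly.aeval, Matrix.map_zero _ Polynomial.C_0, sub_zero] at hC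
  refine ⟨C *ᵥ x, ?_⟩
  rw [Matrix.mulVecLin_apply, Matrix.mulVec_mulVec, ← hC]
  ext i
  simp [Matrix.mulVec_diagonal]

end BlockWiedemann

/-! ### Annihilators of projected sequences and faithfulness -/

namespace BlockWiedemann

variable {F : Type*} [Field F] {ι κ : Type*} [Fintype ι] [DecidableEq ι]
  [Fintype κ] [DecidableEq κ] {b : ℕ}

/-- The image in `F^n` of a polynomial column, where `x` acts as `A` and the coordinate vectors go
to the columns of `V`. -/
noncomputable def krylovSum (A : Matrix ι ι F) (V : Matrix ι (Fin b) F) (v : Fin b → F[X]) :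
    ι → F :=
  ∑ j, Polynomial.aeval A (v j) *ᵥ V.col j

theorem krylovSum_smul (A : Matrix ι ι F) (V : Matrix ι (Fin b) F) (p : F[X])
    (v : Fin b → F[X]) : krylovSum A V (p • v) = Polynomial.aeval A p *ᵥ krylovSum A V v := by
  simp only [krylovSum, Pi.smul_apply, smul_eq_mul, map_mul, ← Matrix.mulVec_mulVec]
  rw [Matrix.mulVec_sum]

theorem krylovSum_add (A : Matrix ι ι F) (V : Matrix ι (Fin b) F) (v w : Fin b → F[X]) :
    krylovSum A V (v + w) = krylovSum A V v + krylovSum A V w := by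
  simp [krylovSum, Matrix.add_mulVec, Finset.sum_add_distrib]

theorem krylovSum_zero (A : Matrix ι ι F) (V : Matrix ι (Fin b) F) :
    krylovSum A V 0 = 0 := by
  simp [krylovSum]

/-- In `S_{k+i} = Uᵀ A^k A^i V` the factor `Uᵀ A^k` does not depend on `i` and leaves the sum. -/
theorem seqMulVec_projection (A : Matrix ι ι F) (U V : Matrix ι (Fin b) F) (v : Fin b → F[X])
    (k : ℕ) : seqMulVec (projection A U V) v k = Uᵀ *ᵥ (A ^ k *ᵥ krylovSum A V v) := by
  have hcol (p : F[X]) (j : Fin b) : Uᵀ *ᵥ (A ^ k *ᵥ (Polynomial.aeval A p *ᵥ V.col j)) =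
      fun a => p.sum fun i c => projection A U V (k + i) a j * c := by
    rw [Polynomial.aeval_eq_sum_range' (Nat.lt_succ_self _)]
    funext a
    rw [Polynomial.sum_over_range' _ (by simp) _ (Nat.lt_succ_self _), Matrix.sum_mulVec,
      Matrix.mulVec_sum, Matrix.mulVec_sum, Finset.sum_apply]
    refine Finset.sum_congr rfl fun i _ => ?_
    rw [Matrix.smul_mulVec, Matrix.mulVec_smul, Matrix.mulVec_smul, Pi.smul_apply, smul_eq_mul,
      mul_comm, Matrix.mulVec_mulVec, Matrix.mulVec_mulVec, Matrix.mul_assoc, ← pow_add]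
    rfl
  rw [krylovSum, Matrix.mulVec_sum, Matrix.mulVec_sum]
  funext a
  simp only [hcol, Finset.sum_apply]
  rfl

theorem mulVec_aeval_eq_zero {A : Matrix ι ι F} {U : Matrix ι (Fin b) F} {w : ι → F}
    (h : ∀ k, Uᵀ *ᵥ (A ^ k *ᵥ w) = 0) (p : F[X]) : Uᵀ *ᵥ (Polynomial.aeval A p *ᵥ w) = 0 := by
  rw [Polynomial.aeval_eq_sum_range, Matrix.sum_mulVec, Matrix.mulVec_sum]
  exact Finset.sum_eq_zero fun i _ => by rw [Matrix.smul_mulVec, Matrix.mulVec_smul, h, smul_zero]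

/-- The submodule of polynomial columns that annihilate the `(U, V)`-projection of `A`. -/
noncomputable def annihilator (A : Matrix ι ι F) (U V : Matrix ι (Fin b) F) :
    Submodule F[X] (Fin b → F[X]) where
  carrier := {v | ∀ k, seqMulVec (projection A U V) v k = 0}
  add_mem' {v w} hv hw k := by
    have hv := hv k
    have hw := hw k
    rw [seqMulVec_projection] at hv hw ⊢
    rw [krylovSum_add, Matrix.mulVec_add, Matrix.mulVec_add, hv, hw, add_zero]
  zero_mem' k := by simp [seqMulVec_projection, krylovSum_zero]
  smul_mem' p v hv k := by
    simp only [Set.mem_ofPred_eq, seqMulVec_projection] at hv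
    have := mulVec_aeval_eq_zero hv (Polynomial.X ^ k * p)
    rw [map_mul, map_pow, Polynomial.aeval_X, ← Matrix.mulVec_mulVec] at this
    rw [seqMulVec_projection, krylovSum_smul, this]

theorem mem_annihilator {A : Matrix ι ι F} {U V : Matrix ι (Fin b) F} {v : Fin b → F[X]} :
    v ∈ annihilator A U V ↔ ∀ k, Uᵀ *ᵥ (A ^ k *ᵥ krylovSum A V v) = 0 := by
  simp only [← seqMulVec_projection]
  rfl

/-- Used twice: for the full rank of the annihilator, hence the existence of generators, and for the
coprimality of their invariant factors. -/
theorem minpoly_smul_mem_annihilator (A : Matrix ι ι F) (U V : Matrix ι (Fin b) F)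
    (v : Fin b → F[X]) : minpoly F A • v ∈ annihilator A U V :=
  mem_annihilator.2 fun k => by simp [krylovSum_smul, minpoly.aeval]

theorem minpoly_matrix_ne_zero (A : Matrix ι ι F) : minpoly F A ≠ 0 :=
  minpoly.ne_zero (Matrix.isIntegral A)

theorem aeval_fromBlocks (A : Matrix ι ι F) (B : Matrix κ κ F) (p : F[X]) :
    Polynomial.aeval (Matrix.fromBlocks A 0 0 B) p =
      Matrix.fromBlocks (Polynomial.aeval A p) 0 0 (Polynomial.aeval B p) := by
  induction p using Polynomial.induction_on with
  | C a =>
    ext (i | i) (j | j) <;> simp [Matrix.algebraMap_eq_diagonal, Matrix.diagonal_apply]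
  | add p q hp hq => simp [hp, hq, Matrix.fromBlocks_add]
  | monomial n a ih =>
    rw [pow_succ, ← mul_assoc]
    generalize Polynomial.C a * Polynomial.X ^ n = q at ih
    simp [ih, Matrix.fromBlocks_multiply]

theorem annihilator_fromBlocks (A : Matrix ι ι F) (B : Matrix κ κ F)
    (hAB : IsCoprime (minpoly F A) (minpoly F B)) (U V : Matrix (ι ⊕ κ) (Fin b) F) :
    annihilator (Matrix.fromBlocks A 0 0 B) U V =
      annihilator A U.toRows₁ V.toRows₁ ⊓ annihilator B U.toRows₂ V.toRows₂ := by
  ext v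
  have hk : krylovSum (Matrix.fromBlocks A 0 0 B) V v =
      Sum.elim (krylovSum A V.toRows₁ v) (krylovSum B V.toRows₂ v) := by
    have hc (j) : V.col j = Sum.elim (V.toRows₁.col j) (V.toRows₂.col j) := by
      ext (i | i) <;> rfl
    simp only [krylovSum, aeval_fromBlocks, hc, Matrix.fromBlocks_mulVec, Sum.elim_comp_inl, Sum.elim_comp_inr]
    ext (i | i) <;> simp
  have hU (x : ι → F) (y : κ → F) : Uᵀ *ᵥ Sum.elim x y = U.toRows₁ᵀ *ᵥ x + U.toRows₂ᵀ *ᵥ y := by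
    ext i
    simp [Matrix.mulVec, dotProduct]
  rw [Submodule.mem_inf, mem_annihilator, mem_annihilator, mem_annihilator, hk]
  have hp (p : F[X]) : Uᵀ *ᵥ (Polynomial.aeval (Matrix.fromBlocks A 0 0 B) p *ᵥ
      Sum.elim (krylovSum A V.toRows₁ v) (krylovSum B V.toRows₂ v)) =
      U.toRows₁ᵀ *ᵥ (Polynomial.aeval A p *ᵥ krylovSum A V.toRows₁ v) +
      U.toRows₂ᵀ *ᵥ (Polynomial.aeval B p *ᵥ krylovSum B V.toRows₂ v) := by
    rw [aeval_fromBlocks, Matrix.fromBlocks_mulVec, Sum.elim_comp_inl, Sum.elim_comp_inr, hU]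
    simp
  constructor
  · intro h
    obtain ⟨u, w, huw⟩ := hAB
    -- `w * minpoly F B` is `1` at `A` and `0` at `B`, so it isolates the first summand; `u *
    -- minpoly F A` isolates the second.
    have hA : Polynomial.aeval A (w * minpoly F B) = 1 := by
      simpa [minpoly.aeval] using congrArg (Polynomial.aeval A) huw
    have hB : Polynomial.aeval B (u * minpoly F A) = 1 := by
      simpa [minpoly.aeval] using congrArg (Polynomial.aeval B) huw
    constructor
    · intro k
      have := mulVec_aeval_eq_zero h (Polynomial.X ^ k * (w * minpoly F B))
      rw [hp, map_mul, hA, map_mul, map_mul (Polynomial.aeval B) w, minpoly.aeval] at this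
      simpa using this
    · intro k
      have := mulVec_aeval_eq_zero h (Polynomial.X ^ k * (u * minpoly F A))
      rw [hp, map_mul (Polynomial.aeval B), hB, map_mul, map_mul (Polynomial.aeval A) u,
        minpoly.aeval] at this
      simpa using this
  · rintro ⟨h₁, h₂⟩ k
    have := hp (Polynomial.X ^ k)
    rw [map_pow, map_pow, map_pow, Polynomial.aeval_X, Polynomial.aeval_X, Polynomial.aeval_X,
      h₁, h₂, add_zero] at this
    exact this

theorem MinimallyGenerates.range_eq {A : Matrix ι ι F} {U V : Matrix ι (Fin b) F}
    {G : Matrix (Fin b) (Fin b) F[X]} (h : MinimallyGenerates (projection A U V) G) :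
    LinearMap.range G.mulVecLin = annihilator A U V := by
  rw [Matrix.range_mulVecLin]
  exact SetLike.coe_injective h.2

theorem exists_minimallyGenerates (A : Matrix ι ι F) (U V : Matrix ι (Fin b) F) :
    ∃ G, MinimallyGenerates (projection A U V) G := by
  obtain ⟨P, a, ha, hL⟩ := exists_range_eq_of_smul_mem (minpoly_matrix_ne_zero A)
    (minpoly_smul_mem_annihilator A U V)
  refine ⟨(P : Matrix (Fin b) (Fin b) F[X]) * Matrix.diagonal a, ⟨?_, fun k => ?_⟩, ?_⟩
  · rw [Matrix.det_mul, Matrix.det_diagonal]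
    exact mul_ne_zero ((Matrix.isUnit_iff_isUnit_det _).1 P.isUnit).ne_zero
      (Finset.prod_ne_zero_iff.2 fun i _ => ha i)
  · refine Matrix.ext fun i c => ?_
    have hc : ((P : Matrix (Fin b) (Fin b) F[X]) * Matrix.diagonal a).col c ∈
        annihilator A U V := by
      rw [hL, Matrix.range_mulVecLin]
      exact Submodule.subset_span ⟨c, rfl⟩
    exact congrFun (hc k) i
  · rw [Matrix.range_mulVecLin] at hL
    exact congrArg SetLike.coe hL.symm

/-- All minimal generators have the annihilator as column module, hence the same invariant factors,
so any one of them may be tested. -/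
theorem exists_faithful_iff {A : Matrix ι ι F} {U V : Matrix ι (Fin b) F}
    {G : Matrix (Fin b) (Fin b) F[X]} {s t : ℕ → F[X]} {r : ℕ}
    (hG : MinimallyGenerates (projection A U V) G) (hs : IsInvariantFactors G s)
    (ht : IsInvariantFactors A.charmatrix t) :
    (∃ G, MinimallyGenerates (projection A U V) G ∧ Faithful r G A) ↔ ∀ i < r, s i = t i := by
  constructor
  · rintro ⟨G', hG', s', t', hs', ht', h⟩
    rwa [hs'.unique hs (hG'.range_eq.trans hG.range_eq.symm), ht'.unique ht rfl] at h
  · exact fun h => ⟨G, hG, s, t, hs, ht, h⟩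

/-- `s₁` is coprime to `t₂`, so it divides `t₁`, and conversely; being monic, they are equal and
cancel. -/
theorem monic_mul_eq_mul_iff {f g s₁ s₂ t₁ t₂ : F[X]} (hfg : IsCoprime f g) (hs₁ : s₁.Monic)
    (ht₁ : t₁.Monic) (hsf : s₁ ∣ f) (htf : t₁ ∣ f)
    (hsg : s₂ ∣ g) (htg : t₂ ∣ g) : s₁ * s₂ = t₁ * t₂ ↔ s₁ = t₁ ∧ s₂ = t₂ := by
  refine ⟨fun h => ?_, fun h => by rw [h.1, h.2]⟩
  have h₁ : s₁ ∣ t₁ := ((hfg.of_isCoprime_of_dvd_left hsf).of_isCoprime_of_dvd_right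
    htg).dvd_of_dvd_mul_right (h ▸ dvd_mul_right _ _)
  have h₂ : t₁ ∣ s₁ := ((hfg.of_isCoprime_of_dvd_left htf).of_isCoprime_of_dvd_right
    hsg).dvd_of_dvd_mul_right (h ▸ dvd_mul_right _ _)
  have heq : s₁ = t₁ :=
    Polynomial.eq_of_monic_of_associated hs₁ ht₁ (associated_of_dvd_dvd h₁ h₂)
  subst heq
  exact ⟨rfl, mul_left_cancel₀ hs₁.ne_zero h⟩

theorem exists_faithful_fromBlocks_iff {A : Matrix ι ι F} {B : Matrix κ κ F}
    (hAB : IsCoprime (minpoly F A) (minpoly F B)) (r : ℕ) (U V : Matrix (ι ⊕ κ) (Fin b) F) :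
    (∃ G, MinimallyGenerates (projection (Matrix.fromBlocks A 0 0 B) U V) G ∧
      Faithful r G (Matrix.fromBlocks A 0 0 B)) ↔
    (∃ G, MinimallyGenerates (projection A U.toRows₁ V.toRows₁) G ∧ Faithful r G A) ∧
    (∃ G, MinimallyGenerates (projection B U.toRows₂ V.toRows₂) G ∧ Faithful r G B) := by
  obtain ⟨G, hG⟩ := exists_minimallyGenerates (Matrix.fromBlocks A 0 0 B) U V
  obtain ⟨G₁, hG₁⟩ := exists_minimallyGenerates A U.toRows₁ V.toRows₁
  obtain ⟨G₂, hG₂⟩ := exists_minimallyGenerates B U.toRows₂ V.toRows₂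
  obtain ⟨s, hs⟩ := exists_isInvariantFactors hG.1.1
  obtain ⟨s₁, hs₁⟩ := exists_isInvariantFactors hG₁.1.1
  obtain ⟨s₂, hs₂⟩ := exists_isInvariantFactors hG₂.1.1
  obtain ⟨t, ht⟩ := exists_isInvariantFactors
    (M := (Matrix.fromBlocks A 0 0 B).charmatrix) (Matrix.charpoly_monic _).ne_zero
  obtain ⟨t₁, ht₁⟩ := exists_isInvariantFactors
    (M := A.charmatrix) (Matrix.charpoly_monic _).ne_zero
  obtain ⟨t₂, ht₂⟩ := exists_isInvariantFactors
    (M := B.charmatrix) (Matrix.charpoly_monic _).ne_zero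
  rw [exists_faithful_iff hG hs ht, exists_faithful_iff hG₁ hs₁ ht₁,
    exists_faithful_iff hG₂ hs₂ ht₂]
  have hm₁ (x) : minpoly F A • x ∈ LinearMap.range G₁.mulVecLin :=
    hG₁.range_eq ▸ minpoly_smul_mem_annihilator _ _ _ x
  have hm₂ (x) : minpoly F B • x ∈ LinearMap.range G₂.mulVecLin :=
    hG₂.range_eq ▸ minpoly_smul_mem_annihilator _ _ _ x
  have hsm := hs.eq_mul_of_range_inf hs₁ hs₂ hAB hm₁ hm₂ (by
    rw [hG.range_eq, hG₁.range_eq, hG₂.range_eq, annihilator_fromBlocks A B hAB])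
  rw [Matrix.charmatrix_fromBlocks, Matrix.map_zero _ Polynomial.C_0,
    Matrix.map_zero _ Polynomial.C_0, neg_zero, neg_zero] at ht
  have htm := ht.eq_mul_of_fromBlocks ht₁ ht₂ hAB (minpoly_smul_mem_range_charmatrix A)
    (minpoly_smul_mem_range_charmatrix B)
  have hiff (i : ℕ) : s i = t i ↔ s₁ i = t₁ i ∧ s₂ i = t₂ i := by
    rw [hsm, htm]
    exact monic_mul_eq_mul_iff hAB (hs₁.1 i) (ht₁.1 i)
      (hs₁.dvd_of_smul_mem hm₁ i) (ht₁.dvd_of_smul_mem (minpoly_smul_mem_range_charmatrix A) i)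
      (hs₂.dvd_of_smul_mem hm₂ i) (ht₂.dvd_of_smul_mem (minpoly_smul_mem_range_charmatrix B) i)
  simp only [hiff]
  exact ⟨fun h => ⟨fun i hi => (h i hi).1, fun i hi => (h i hi).2⟩,
    fun h i hi => ⟨h.1 i hi, h.2 i hi⟩⟩

/-- Splitting the rows of a pair of matrices. -/
def pairRowsEquiv (F ι κ : Type*) (b : ℕ) :
    Matrix (ι ⊕ κ) (Fin b) F × Matrix (ι ⊕ κ) (Fin b) F ≃
      (Matrix ι (Fin b) F × Matrix ι (Fin b) F) × (Matrix κ (Fin b) F × Matrix κ (Fin b) F) where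
  toFun UV := ((UV.1.toRows₁, UV.2.toRows₁), (UV.1.toRows₂, UV.2.toRows₂))
  invFun W := (Matrix.fromRows W.1.1 W.2.1, Matrix.fromRows W.1.2 W.2.2)
  left_inv UV := by simp
  right_inv W := by simp

end BlockWiedemann

theorem mainTheorem6 {F : Type*} [Field F] [Finite F]
    {ι κ : Type*} [Fintype ι] [DecidableEq ι] [Fintype κ] [DecidableEq κ]
    (A : Matrix ι ι F) (B : Matrix κ κ F)
    (hAB : IsCoprime (minpoly F A) (minpoly F B)) (b r : ℕ) :
    BlockWiedemann.faithfulProb b r (Matrix.fromBlocks A 0 0 B) =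
      BlockWiedemann.faithfulProb b r A * BlockWiedemann.faithfulProb b r B := by
  unfold BlockWiedemann.faithfulProb
  -- Splitting rows turns both the sample space and the set of favourable pairs into products.
  rw [div_mul_div_comm, ← Nat.cast_mul, ← Nat.cast_mul, ← Nat.card_prod, ← Nat.card_prod,
    Nat.card_congr (BlockWiedemann.pairRowsEquiv F ι κ b)]
  congr 2
  refine Nat.card_congr (Equiv.trans (Equiv.subtypeEquiv (BlockWiedemann.pairRowsEquiv F ι κ b)
    fun UV => ?_) Equiv.subtypeProdEquivProd)
  exact BlockWiedemann.exists_faithful_fromBlocks_iff hAB r UV.1 UV.2
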